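/- Let $p$ be a prime, let $n\ge 2$ and $m$ be natural numbers, and let $G=(G_1,\dots,G_n)$ be a system of polynomials $G_j\in\mathbb F_p[X_1,\dots,X_m]$. Let $\mathbb T^n=(\mathbb R/\mathbb Z)^n$ with Lebesgue probability measure $\mu$, and for $B\subseteq\mathbb T^n$ put $$\mu_G(B)=\frac{\#\{x\in\mathbb F_p^m:\ (G_1(x)/p,\dots,G_n(x)/p)\in B\}}{p^m}.$$ For $v\in\mathbb Z^n$ let $S_G(v)=\sum_{x\in\mathbb F_p^m}\exp\big(\tfrac{2\pi i}{p}\sum_{j=1}^n v_jG_j(x)\big)$. For $\eta\ge 0$ and a real constant $K$, say that $G$ is of type $\eta$ with constant $K$ if $|S_G(v)|/p^m\le K$ for all $v\in p\mathbb Z^n$ and $|S_G(v)|/p^m\le Kp^{-\eta}$ for all $v\in\mathbb Z^n\setminus p\mathbb Z^n$. Let $B_R(y)\subset\mathbb T^n$ be the closed Euclidean (geodesic) ball of radius $R$ with center $y$, and let $B_R=B_R(0)$. For every $n\ge2$ and every $K$ there is a constant $C>0$, depending only on $n$ and $K$, such that for every prime $p$, every $m$, every $\eta\ge0$, every system $G$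 of $n$ polynomials in $m$ variables over $\mathbb F_p$ that is of type $\eta$ with constant $K$, and every $0<R<1/2$, $$\mathrm{Var}(\mu_G,B_R):=\int_{\mathbb T^n}\big(\mu_G(B_R(y))-\mu(B_R)\big)^2\,dy\ \le\ C\,\frac{R^n}{p^{\min(2\eta,n)}}.$$ -/

import Mathlib

open MeasureTheory

noncomputable section

/-- A polynomial system over `𝔽_p`: `n` polynomials in `m` variables. -/
abbrev PolySystem (p n m : ℕ) : Type := Fin n → MvPolynomial (Fin m) (ZMod p)

namespace PolySystem

variable {p n m : ℕ} [Fact p.Prime]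

/-- The point `(G₁(x)/p, …, Gₙ(x)/p)` of the torus `𝕋ⁿ = (ℝ/ℤ)ⁿ` attached to `x ∈ 𝔽_p^m`;
`ZMod.toAddCircle` is the map `a ↦ a / p mod 1`. -/
def point (G : PolySystem p n m) (x : Fin m → ZMod p) : UnitAddTorus (Fin n) :=
  fun j => ZMod.toAddCircle (MvPolynomial.eval x (G j))

/-- `μ_G(B)`: the proportion of the `p ^ m` points of the system (with multiplicity)
that lie in `B`. -/
def mu (G : PolySystem p n m) (B : Set (UnitAddTorus (Fin n))) : ℝ :=
  (Nat.card {x : Fin m → ZMod p // G.point x ∈ B} : ℝ) / (p : ℝ) ^ m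

/-- The Weyl sum `S_G(v) = ∑_{x ∈ 𝔽_p^m} e_p(v₁ G₁(x) + ⋯ + vₙ Gₙ(x))`;
`ZMod.stdAddChar` is the character `a ↦ exp (2 π i a / p)`. -/
def weylSum (G : PolySystem p n m) (v : Fin n → ℤ) : ℂ :=
  ∑ x : Fin m → ZMod p, ZMod.stdAddChar (∑ j, (v j : ZMod p) * MvPolynomial.eval x (G j))

open Classical in
/-- `G` is of type `η`, with implied constant `K`. -/
def IsOfType (G : PolySystem p n m) (η K : ℝ) : Prop :=
  0 ≤ η ∧ ∀ v : Fin n → ℤ,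
    ‖G.weylSum v‖ / (p : ℝ) ^ m ≤ K * (if ∀ j, (p : ℤ) ∣ v j then 1 else (p : ℝ) ^ (-η))

/-- `Var(μ_G, B) = ∫_{𝕋ⁿ} (μ_G(B(y)) - μ(B))² dy`, where `B(y) = y + B` and `μ` is the Lebesgue
(probability) measure on `𝕋ⁿ`. -/
def variance (G : PolySystem p n m) (B : Set (UnitAddTorus (Fin n))) : ℝ :=
  ∫ y : UnitAddTorus (Fin n), (G.mu ((fun x => y + x) '' B) - volume.real B) ^ 2

end PolySystem

/-- The closed geodesic (Euclidean) ball of radius `R` around `y` in the flat torus `𝕋ⁿ`. The norm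
on `ℝ/ℤ` is the distance to the nearest integer, so `√(∑ j, ‖x j - y j‖ ^ 2)` is the Euclidean
distance between the nearest lifts of `x` and `y` to `ℝⁿ`. -/
def torusBall {n : ℕ} (R : ℝ) (y : UnitAddTorus (Fin n)) : Set (UnitAddTorus (Fin n)) :=
  {x | √(∑ j, ‖x j - y j‖ ^ 2) ≤ R}

end

/-!
By Parseval's identity the variance is
`∑_{v ≠ 0} (|S_G(v)| / p ^ m) ^ 2 * |χ̂(v)| ^ 2`, where `χ` is the indicator function of the ball of
radius `R` about `0` in the torus (`PolySystem.mFourierCoeff_mu`,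
`PolySystem.variance_le_of_sum_le`).

The frequencies `v` not divisible by `p` contribute at most `K² p ^ (-2η) ∑_v |χ̂(v)|²`, which is
`K² p ^ (-2η)` times the volume of the ball, and the volume is a constant times `R ^ n`.

For `v = p w` with `w ≠ 0` the hypothesis only bounds the Weyl sum by `K`, and one needs
`∑_{w ≠ 0} |χ̂(p w)|² ≪ R ^ n / p ^ n`: a bound for the variance of the number of lattice points in
a randomly shifted ball. It follows from the decay
`|χ̂(v)|² ≪ R ^ (2n) (1 + R |v|) ^ (-(n + 1))` (`exists_norm_mFourierCoeff_ballIndicator_sq_le`) and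
from `∑_{w ≠ 0} (1 + l |w|) ^ (-(n + 1)) ≪ l ^ (-n)`, valid for all `l > 0` and used with `l = R p`
(`exists_sum_lattice_le`).

As `R < 1/2`, `χ̂` is the Fourier transform of a Euclidean ball. A reflection and slicing reduce it
to the one-dimensional integral of `(1 - t²) ^ ((n - 1) / 2) e ^ (i s t)` over `[-1, 1]`
(`setIntegral_euclideanBall_cexp`). Its decay `s ^ (-(n + 1) / 2)` is proved by repeated integration
by parts, with an extra polynomial factor to make the induction close
(`exists_norm_integral_weight_le`).
-/

/-! ### Oscillatory integrals with weight `(1 - t ^ 2) ^ β` -/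

open Polynomial in
/-- The polynomial `Q` for which `P (1 - t²) ^ β` has derivative `Q (1 - t²) ^ (β - 1)`. -/
noncomputable def weightDeriv (β : ℝ) (P : ℝ[X]) : ℝ[X] :=
  derivative P * (1 - X ^ 2) - C (2 * β) * X * P

lemma hasDerivAt_poly_mul_weight (β : ℝ) (P : Polynomial ℝ) {t : ℝ} (ht : 0 < 1 - t ^ 2) :
    HasDerivAt (fun t : ℝ => P.eval t * (1 - t ^ 2) ^ β)
      ((weightDeriv β P).eval t * (1 - t ^ 2) ^ (β - 1)) t := by
  have h1 : HasDerivAt (fun t : ℝ => 1 - t ^ 2) (-(2 * t)) t := by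
    simpa using (hasDerivAt_pow 2 t).const_sub 1
  have h2 := (P.hasDerivAt t).mul (h1.rpow_const (p := β) (Or.inl ht.ne'))
  refine h2.congr_deriv ?_
  have h3 : (1 - t ^ 2) ^ β = (1 - t ^ 2) * (1 - t ^ 2) ^ (β - 1) := by
    rw [Real.rpow_sub_one ht.ne']; field_simp
  rw [h3]
  simp only [weightDeriv, Polynomial.eval_sub, Polynomial.eval_mul, Polynomial.eval_one,
    Polynomial.eval_pow, Polynomial.eval_X, Polynomial.eval_C]
  ring

lemma one_sub_sq_pos {t : ℝ} (h : t ∈ Set.Ioo (-1 : ℝ) 1) : 0 < 1 - t ^ 2 := by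
  nlinarith [h.1, h.2]

lemma continuous_weight {β : ℝ} (hβ : 0 ≤ β) : Continuous (fun t : ℝ => (1 - t ^ 2) ^ β) :=
  (by fun_prop : Continuous fun t : ℝ => 1 - t ^ 2).rpow_const fun _ => Or.inr hβ

lemma intervalIntegrable_weight {β : ℝ} (hβ : β = -(1 / 2) ∨ 0 ≤ β) :
    IntervalIntegrable (fun t : ℝ => (1 - t ^ 2) ^ β) volume (-1) 1 := by
  rcases hβ with rfl | hβ
  · refine intervalIntegral.intervalIntegrable_deriv_of_nonneg (g := Real.arcsin)
      Real.continuous_arcsin.continuousOn (fun t ht => ?_) (fun t ht => ?_)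
    · rw [min_eq_left (by norm_num), max_eq_right (by norm_num)] at ht
      have := Real.hasDerivAt_arcsin (x := t) (by linarith [ht.1]) (by linarith [ht.2])
      refine this.congr_deriv ?_
      rw [Real.rpow_neg (one_sub_sq_pos ht).le, ← Real.sqrt_eq_rpow, one_div]
    · rw [min_eq_left (by norm_num), max_eq_right (by norm_num)] at ht
      exact Real.rpow_nonneg (one_sub_sq_pos ht).le _
  · exact (continuous_weight hβ).intervalIntegrable _ _

lemma norm_cexp_I_mul (s t : ℝ) : ‖Complex.exp (Complex.I * s * t)‖ = 1 := by
  rw [show Complex.I * s * t = ((s * t : ℝ) : ℂ) * Complex.I by push_cast; ring]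
  exact Complex.norm_exp_ofReal_mul_I _

/-- Integration by parts against an exponential, in the form of an inequality. -/
lemma norm_integral_mul_cexp_le {u u' : ℝ → ℝ} {a b s : ℝ} (hab : a ≤ b) (hs : 0 < s)
    (hu : ContinuousOn u (Set.Icc a b)) (hd : ∀ t ∈ Set.Ioo a b, HasDerivAt u (u' t) t)
    (hi : IntervalIntegrable u' volume a b) :
    ‖∫ t in a..b, (u t : ℂ) * Complex.exp (Complex.I * s * t)‖ ≤
      (|u a| + |u b| + ‖∫ t in a..b, (u' t : ℂ) * Complex.exp (Complex.I * s * t)‖) / s := by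
  have hc : Complex.I * (s : ℂ) ≠ 0 := by simp [hs.ne']
  have hexp : ∀ t : ℝ, HasDerivAt
      (fun t : ℝ => Complex.exp (Complex.I * s * t) / (Complex.I * s))
      (Complex.exp (Complex.I * s * t)) t := by
    intro t
    have h1 : HasDerivAt (fun t : ℝ => Complex.I * s * (t : ℂ)) (Complex.I * s) t := by
      simpa using (Complex.ofRealCLM.hasDerivAt (x := t)).const_mul (Complex.I * (s : ℂ))
    exact (h1.cexp.div_const (Complex.I * s)).congr_deriv (mul_div_cancel_right₀ _ hc)
  have key := intervalIntegral.integral_mul_deriv_eq_deriv_mul_of_hasDerivAt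
    (a := a) (b := b) (u := fun t => (u t : ℂ)) (u' := fun t => (u' t : ℂ))
    (v := fun t : ℝ => Complex.exp (Complex.I * s * t) / (Complex.I * s))
    (v' := fun t : ℝ => Complex.exp (Complex.I * s * t))
    (by rw [Set.uIcc_of_le hab]; exact Complex.continuous_ofReal.comp_continuousOn hu)
    (fun t _ => (hexp t).continuousAt.continuousWithinAt)
    (by rw [min_eq_left hab, max_eq_right hab]; exact fun t ht => (hd t ht).ofReal_comp)
    (fun t _ => hexp t) ⟨hi.1.ofReal, hi.2.ofReal⟩
    ((by fun_prop : Continuous fun t : ℝ => Complex.exp (Complex.I * s * t)).intervalIntegrable _ _)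
  have hsn : ‖Complex.I * (s : ℂ)‖ = s := by simp [abs_of_pos hs]
  simp only [← mul_div_assoc, intervalIntegral.integral_div, ← sub_div] at key
  rw [key, norm_div, hsn]
  gcongr
  refine (norm_sub_le _ _).trans (add_le_add_left ((norm_sub_le _ _).trans ?_) _)
  rw [norm_mul, norm_mul, norm_cexp_I_mul, norm_cexp_I_mul]
  simp [add_comm]

lemma Polynomial.exists_abs_eval_le (P : Polynomial ℝ) :
    ∃ M, 0 ≤ M ∧ ∀ t ∈ Set.Icc (-1 : ℝ) 1, |P.eval t| ≤ M := by
  obtain ⟨M, hM⟩ := isCompact_Icc.exists_bound_of_continuousOn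
    (P.continuous.continuousOn (s := Set.Icc (-1 : ℝ) 1))
  exact ⟨M, (norm_nonneg _).trans (hM 0 (by norm_num)), hM⟩

lemma integral_rpow_neg_half {δ : ℝ} :
    ∫ u in (0 : ℝ)..δ, u ^ (-(1 / 2) : ℝ) = 2 * δ ^ (1 / 2 : ℝ) := by
  rw [integral_rpow (Or.inl (by norm_num))]
  norm_num
  ring

/-- The two ends of the interval contribute `O(√δ)`. -/
lemma integral_weight_ends_le {δ : ℝ} (h0 : 0 < δ) (h1 : δ ≤ 1) :
    (∫ t in (-1 : ℝ)..(-1 + δ), (1 - t ^ 2) ^ (-(1 / 2) : ℝ)) ≤ 2 * δ ^ (1 / 2 : ℝ) ∧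
    (∫ t in (1 - δ)..(1 : ℝ), (1 - t ^ 2) ^ (-(1 / 2) : ℝ)) ≤ 2 * δ ^ (1 / 2 : ℝ) := by
  have hw := intervalIntegrable_weight (Or.inl (Eq.refl (-(1 / 2) : ℝ)))
  have hr : IntervalIntegrable (fun u : ℝ => u ^ (-(1 / 2) : ℝ)) volume 0 δ :=
    intervalIntegral.intervalIntegrable_rpow' (by norm_num)
  have e1 : ∫ t in (-1 : ℝ)..(-1 + δ), (1 + t) ^ (-(1 / 2) : ℝ) = 2 * δ ^ (1 / 2 : ℝ) := by
    rw [intervalIntegral.integral_comp_add_left (fun u : ℝ => u ^ (-(1 / 2) : ℝ)) 1,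
      ← integral_rpow_neg_half]
    congr 1 <;> ring
  have e2 : ∫ t in (1 - δ)..(1 : ℝ), (1 - t) ^ (-(1 / 2) : ℝ) = 2 * δ ^ (1 / 2 : ℝ) := by
    rw [intervalIntegral.integral_comp_sub_left (fun u : ℝ => u ^ (-(1 / 2) : ℝ)) 1,
      ← integral_rpow_neg_half]
    congr 1 <;> ring
  have i1 : IntervalIntegrable (fun t : ℝ => (1 + t) ^ (-(1 / 2) : ℝ)) volume (-1) (-1 + δ) := by
    have := hr.comp_add_left 1
    simpa [neg_add_eq_sub] using this
  have i2 : IntervalIntegrable (fun t : ℝ => (1 - t) ^ (-(1 / 2) : ℝ)) volume (1 - δ) 1 := by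
    have := (hr.comp_sub_left 1).symm
    simpa using this
  constructor
  · rw [← e1]
    refine intervalIntegral.integral_mono_on_of_le_Ioo (by linarith) (hw.mono_set ?_) i1 ?_
    · rw [Set.uIcc_of_le (by linarith), Set.uIcc_of_le (by linarith)]
      exact Set.Icc_subset_Icc le_rfl (by linarith)
    · intro t ht
      exact Real.rpow_le_rpow_of_nonpos (by linarith [ht.1]) (by nlinarith [ht.1, ht.2])
        (by norm_num)
  · rw [← e2]
    refine intervalIntegral.integral_mono_on_of_le_Ioo (by linarith) (hw.mono_set ?_) i2 ?_
    · rw [Set.uIcc_of_le (by linarith), Set.uIcc_of_le (by linarith)]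
      exact Set.Icc_subset_Icc (by linarith) le_rfl
    · intro t ht
      exact Real.rpow_le_rpow_of_nonpos (by linarith [ht.2]) (by nlinarith [ht.1, ht.2])
        (by norm_num)

lemma norm_integral_mul_weight_cexp_le {β M a b s : ℝ} (P : Polynomial ℝ) (hab : a ≤ b)
    (ha : -1 ≤ a) (hb : b ≤ 1) (hM : ∀ t ∈ Set.Icc (-1 : ℝ) 1, |P.eval t| ≤ M)
    (hi : IntervalIntegrable (fun t : ℝ => (1 - t ^ 2) ^ β) volume a b) :
    ‖∫ t in a..b, ((P.eval t * (1 - t ^ 2) ^ β : ℝ) : ℂ) * Complex.exp (Complex.I * s * t)‖ ≤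
      M * ∫ t in a..b, (1 - t ^ 2) ^ β := by
  rw [← intervalIntegral.integral_const_mul]
  refine intervalIntegral.norm_integral_le_of_norm_le hab (ae_of_all _ fun t ht => ?_)
    (hi.const_mul M)
  have h1 : (0 : ℝ) ≤ 1 - t ^ 2 := by nlinarith [ht.1, ht.2]
  rw [norm_mul, norm_cexp_I_mul, mul_one, Complex.norm_real, Real.norm_eq_abs, abs_mul,
    abs_of_nonneg (Real.rpow_nonneg h1 β)]
  exact mul_le_mul_of_nonneg_right (hM t ⟨by linarith [ht.1], by linarith [ht.2]⟩)
    (Real.rpow_nonneg h1 β)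

/-- The case `β = -1/2`: the parts of the interval within `1 / s` of the ends are estimated
trivially, and the rest by parts. -/
lemma exists_norm_integral_weight_neg_half_le (P : Polynomial ℝ) :
    ∃ C, ∀ s : ℝ, 1 ≤ s →
      ‖∫ t in (-1 : ℝ)..1, ((P.eval t * (1 - t ^ 2) ^ (-(1 / 2) : ℝ) : ℝ) : ℂ) *
        Complex.exp (Complex.I * s * t)‖ ≤ C * s ^ (-(1 / 2) : ℝ) := by
  obtain ⟨M, hM0, hM⟩ := P.exists_abs_eval_le
  obtain ⟨N, hN0, hN⟩ := (weightDeriv (-(1 / 2)) P).exists_abs_eval_le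
  refine ⟨6 * M + 2 * N, fun s hs => ?_⟩
  have hs0 : 0 < s := by linarith
  set δ := s⁻¹ with hδ
  have h0 : 0 < δ := by positivity
  have h1 : δ ≤ 1 := inv_le_one_of_one_le₀ hs
  have hδs : δ ^ (1 / 2 : ℝ) = s ^ (-(1 / 2) : ℝ) := by
    rw [hδ, Real.inv_rpow hs0.le, Real.rpow_neg hs0.le]
  have hδs' : δ ^ (-(1 / 2) : ℝ) / s = s ^ (-(1 / 2) : ℝ) := by
    rw [← hδs, div_eq_mul_inv, ← hδ]
    nth_rewrite 2 [← Real.rpow_one δ]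
    rw [← Real.rpow_add h0]; norm_num
  have hw := intervalIntegrable_weight (Or.inl (Eq.refl (-(1 / 2) : ℝ)))
  have hsub : ∀ a b : ℝ, -1 ≤ a → a ≤ b → b ≤ 1 → Set.uIcc a b ⊆ Set.uIcc (-1) 1 := by
    intro a b ha hab hb
    rw [Set.uIcc_of_le hab, Set.uIcc_of_le (by norm_num)]
    exact Set.Icc_subset_Icc ha hb
  have hF : IntervalIntegrable (fun t : ℝ => ((P.eval t * (1 - t ^ 2) ^ (-(1 / 2) : ℝ) : ℝ) : ℂ) *
        Complex.exp (Complex.I * s * t)) volume (-1) 1 := by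
    have h := hw.continuousOn_mul P.continuous.continuousOn
    exact IntervalIntegrable.mul_continuousOn ⟨h.1.ofReal, h.2.ofReal⟩ (by fun_prop)
  have hpos : ∀ t ∈ Set.Icc (-1 + δ) (1 - δ), δ ≤ 1 - t ^ 2 := by
    intro t ht
    nlinarith [mul_nonneg (sub_nonneg.2 ht.1) (sub_nonneg.2 ht.2)]
  have hcont : ∀ (β : ℝ) (Q : Polynomial ℝ),
      ContinuousOn (fun t : ℝ => Q.eval t * (1 - t ^ 2) ^ β) (Set.Icc (-1 + δ) (1 - δ)) := by
    intro β Q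
    refine Q.continuous.continuousOn.mul
      (ContinuousOn.rpow_const (by fun_prop) fun t ht => Or.inl ?_)
    linarith [hpos t ht]
  have hcont' := fun β : ℝ => by simpa using hcont β 1
  have hle : -1 + δ ≤ 1 - δ := by linarith
  have hend : ∀ t ∈ Set.Icc (-1 + δ) (1 - δ), (1 - t ^ 2) ^ (-(1 / 2) : ℝ) ≤ δ ^ (-(1 / 2) : ℝ) :=
    fun t ht => Real.rpow_le_rpow_of_nonpos h0 (hpos t ht) (by norm_num)
  -- `t (1 - t²) ^ (-1/2)` is a primitive of `(1 - t²) ^ (-3/2)`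
  have hmid : ∫ t in (-1 + δ)..(1 - δ), (1 - t ^ 2) ^ (-(1 / 2) - 1 : ℝ) ≤
      2 * δ ^ (-(1 / 2) : ℝ) := by
    have hFTC := intervalIntegral.integral_eq_sub_of_hasDerivAt_of_le hle
      (f := fun t : ℝ => (Polynomial.X : Polynomial ℝ).eval t * (1 - t ^ 2) ^ (-(1 / 2) : ℝ))
      (f' := fun t : ℝ => (1 - t ^ 2) ^ (-(1 / 2) - 1 : ℝ)) (hcont _ _)
      (fun t ht => by
        have hp := hpos t ⟨ht.1.le, ht.2.le⟩
        refine (hasDerivAt_poly_mul_weight (-(1 / 2)) Polynomial.X (h0.trans_le hp)).congr_deriv ?_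
        simp [weightDeriv, ← pow_two])
      ((hcont' _).intervalIntegrable_of_Icc hle)
    rw [hFTC]
    have e1 := hend (1 - δ) ⟨hle, le_rfl⟩
    have e2 := hend (-1 + δ) ⟨le_rfl, hle⟩
    have p1 := Real.rpow_nonneg (h0.le.trans (hpos (1 - δ) ⟨hle, le_rfl⟩)) (-(1 / 2) : ℝ)
    have p2 := Real.rpow_nonneg (h0.le.trans (hpos (-1 + δ) ⟨le_rfl, hle⟩)) (-(1 / 2) : ℝ)
    simp only [Polynomial.eval_X]
    nlinarith
  rw [← intervalIntegral.integral_add_adjacent_intervals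
      (hF.mono_set (hsub (-1) (-1 + δ) le_rfl (by linarith) (by linarith)))
      (hF.mono_set (hsub (-1 + δ) 1 (by linarith) (by linarith) le_rfl)),
    ← intervalIntegral.integral_add_adjacent_intervals
      (hF.mono_set (hsub (-1 + δ) (1 - δ) (by linarith) (by linarith) (by linarith)))
      (hF.mono_set (hsub (1 - δ) 1 (by linarith) (by linarith) le_rfl))]
  have b1 := (norm_integral_mul_weight_cexp_le (s := s) P (by linarith : -1 ≤ -1 + δ) le_rfl
    (by linarith) hM (hw.mono_set (hsub (-1) (-1 + δ) le_rfl (by linarith) (by linarith)))).trans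
    (mul_le_mul_of_nonneg_left (integral_weight_ends_le h0 h1).1 hM0)
  have b3 := (norm_integral_mul_weight_cexp_le (s := s) P (by linarith : 1 - δ ≤ 1) (by linarith)
    le_rfl hM (hw.mono_set (hsub (1 - δ) 1 (by linarith) (by linarith) le_rfl))).trans
    (mul_le_mul_of_nonneg_left (integral_weight_ends_le h0 h1).2 hM0)
  have b2 := norm_integral_mul_cexp_le hle hs0 (hcont (-(1 / 2)) P)
    (fun t ht => hasDerivAt_poly_mul_weight (-(1 / 2)) P
      (h0.trans_le (hpos t ⟨ht.1.le, ht.2.le⟩)))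
    ((hcont _ _).intervalIntegrable_of_Icc hle)
  have b2' := (norm_integral_mul_weight_cexp_le (s := s) (weightDeriv (-(1 / 2)) P) hle
    (by linarith) (by linarith) hN ((hcont' (-(1 / 2) - 1)).intervalIntegrable_of_Icc hle)).trans
    (mul_le_mul_of_nonneg_left hmid hN0)
  have habs : ∀ t ∈ Set.Icc (-1 + δ) (1 - δ),
      |P.eval t * (1 - t ^ 2) ^ (-(1 / 2) : ℝ)| ≤ M * δ ^ (-(1 / 2) : ℝ) := by
    intro t ht
    have h3 := Real.rpow_nonneg (h0.le.trans (hpos t ht)) (-(1 / 2) : ℝ)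
    rw [abs_mul, abs_of_nonneg h3]
    exact mul_le_mul (hM t ⟨by linarith [ht.1], by linarith [ht.2]⟩) (hend t ht) h3 hM0
  have b2'' : ‖∫ t in (-1 + δ)..(1 - δ), ((P.eval t * (1 - t ^ 2) ^ (-(1 / 2) : ℝ) : ℝ) : ℂ) *
        Complex.exp (Complex.I * s * t)‖ ≤ (2 * M + 2 * N) * s ^ (-(1 / 2) : ℝ) := by
    rw [← hδs', ← mul_div_assoc]
    refine b2.trans (div_le_div_of_nonneg_right ?_ hs0.le)
    have := habs (1 - δ) ⟨hle, le_rfl⟩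
    have := habs (-1 + δ) ⟨le_rfl, hle⟩
    linarith
  rw [hδs] at b1 b3
  calc _ ≤ _ := (norm_add_le _ _).trans (add_le_add_right (norm_add_le _ _) _)
    _ ≤ M * (2 * s ^ (-(1 / 2) : ℝ)) + ((2 * M + 2 * N) * s ^ (-(1 / 2) : ℝ) +
        M * (2 * s ^ (-(1 / 2) : ℝ))) := add_le_add b1 (add_le_add b2'' b3)
    _ = _ := by ring

/-- Decay of the Fourier transform of `P(t) (1 - t²) ^ ((k - 1) / 2)` on `[-1, 1]`. Integration by
parts lowers the exponent by one and gains a factor `1 / s`, which leaves the exponents `-1/2`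
and `0`. -/
theorem exists_norm_integral_weight_le (k : ℕ) (P : Polynomial ℝ) :
    ∃ C, ∀ s : ℝ, 1 ≤ s →
      ‖∫ t in (-1 : ℝ)..1, ((P.eval t * (1 - t ^ 2) ^ (((k : ℝ) - 1) / 2) : ℝ) : ℂ) *
        Complex.exp (Complex.I * s * t)‖ ≤ C * s ^ (-(((k : ℝ) + 1) / 2)) := by
  induction k using Nat.twoStepInduction generalizing P with
  | zero =>
    obtain ⟨C, hC⟩ := exists_norm_integral_weight_neg_half_le P
    refine ⟨C, fun s hs => ?_⟩
    convert hC s hs using 6 <;> norm_num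
  | one =>
    obtain ⟨M, hM0, hM⟩ := P.exists_abs_eval_le
    obtain ⟨N, hN0, hN⟩ := P.derivative.exists_abs_eval_le
    refine ⟨M + M + N * 2, fun s hs => ?_⟩
    have hs0 : 0 < s := by linarith
    have h1 := norm_integral_mul_cexp_le (by norm_num : (-1 : ℝ) ≤ 1) hs0
      P.continuous.continuousOn (fun t _ => P.hasDerivAt t)
      (P.derivative.continuous.intervalIntegrable _ _)
    have h2 := norm_integral_mul_weight_cexp_le (β := 0) (s := s) P.derivative
      (by norm_num : (-1 : ℝ) ≤ 1) le_rfl le_rfl hN (intervalIntegrable_weight (Or.inr le_rfl))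
    have h3 : -((((1 : ℕ) : ℝ) + 1) / 2) = -1 := by norm_num
    have h4 : (((1 : ℕ) : ℝ) - 1) / 2 = 0 := by norm_num
    rw [h3, h4, Real.rpow_neg_one, ← div_eq_mul_inv]
    simp only [Real.rpow_zero, mul_one] at h2 ⊢
    refine h1.trans (div_le_div_of_nonneg_right ?_ hs0.le)
    refine add_le_add (add_le_add (hM _ (by norm_num)) (hM _ (by norm_num))) (h2.trans ?_)
    norm_num
  | more k ih _ =>
    set β : ℝ := (((k + 2 : ℕ) : ℝ) - 1) / 2 with hβ
    have hβ1 : β - 1 = ((k : ℝ) - 1) / 2 := by rw [hβ]; push_cast; ring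
    have hk : (0 : ℝ) ≤ k := k.cast_nonneg
    have hβ0 : 0 < β := by linarith
    obtain ⟨C, hC⟩ := ih (weightDeriv β P)
    refine ⟨C, fun s hs => ?_⟩
    have hs0 : 0 < s := by linarith
    have hint : IntervalIntegrable (fun t : ℝ => (1 - t ^ 2) ^ (β - 1)) volume (-1) 1 := by
      refine intervalIntegrable_weight ?_
      rw [hβ1]
      rcases Nat.eq_zero_or_pos k with rfl | hk
      · left; norm_num
      · right
        have : (1 : ℝ) ≤ k := by exact_mod_cast hk
        linarith
    have h1 := norm_integral_mul_cexp_le (by norm_num : (-1 : ℝ) ≤ 1) hs0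
      (P.continuous.mul (continuous_weight hβ0.le)).continuousOn
      (fun t ht => hasDerivAt_poly_mul_weight β P (one_sub_sq_pos ht))
      (hint.continuousOn_mul (weightDeriv β P).continuous.continuousOn)
    have h2 := hC s hs
    rw [← hβ1] at h2
    have h3 : -((((k + 2 : ℕ) : ℝ) + 1) / 2) = -(((k : ℝ) + 1) / 2) - 1 := by push_cast; ring
    rw [h3, Real.rpow_sub_one hs0.ne', ← mul_div_assoc]
    refine h1.trans (div_le_div_of_nonneg_right ?_ hs0.le)
    simpa [Real.zero_rpow hβ0.ne'] using h2

/-! ### Fourier transform of a Euclidean ball -/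

/-- The closed Euclidean ball of radius `R` about `0`, as a subset of `Fin n → ℝ`. -/
def euclideanBall (n : ℕ) (R : ℝ) : Set (Fin n → ℝ) := {x | √(∑ i, x i ^ 2) ≤ R}

lemma toLp_mem_closedBall_iff {n : ℕ} {R : ℝ} (x : Fin n → ℝ) :
    WithLp.toLp 2 x ∈ Metric.closedBall (0 : EuclideanSpace ℝ (Fin n)) R ↔
      x ∈ euclideanBall n R := by
  simp [euclideanBall, EuclideanSpace.norm_eq]

lemma measurableSet_euclideanBall (n : ℕ) (R : ℝ) : MeasurableSet (euclideanBall n R) :=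
  measurableSet_le (by fun_prop) measurable_const

lemma setIntegral_euclideanBall {n : ℕ} {R : ℝ} (f : (Fin n → ℝ) → ℂ) :
    ∫ x in euclideanBall n R, f x =
      ∫ x in Metric.closedBall (0 : EuclideanSpace ℝ (Fin n)) R, f (WithLp.ofLp x) := by
  rw [← (PiLp.volume_preserving_toLp (Fin n)).setIntegral_preimage_emb
    (MeasurableEquiv.toLp 2 (Fin n → ℝ)).measurableEmbedding]
  congr 2
  ext x
  exact (toLp_mem_closedBall_iff x).symm

lemma volume_real_euclideanBall (n : ℕ) {R : ℝ} (hR : 0 ≤ R) :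
    volume.real (euclideanBall n R) =
      R ^ n * volume.real (Metric.ball (0 : EuclideanSpace ℝ (Fin n)) 1) := by
  have h := Measure.addHaar_real_closedBall (volume : Measure (EuclideanSpace ℝ (Fin n))) 0 hR
  rw [finrank_euclideanSpace_fin] at h
  rw [← h, measureReal_def, measureReal_def,
    ← (PiLp.volume_preserving_toLp (Fin n)).measure_preimage
      Metric.isClosed_closedBall.measurableSet.nullMeasurableSet]
  congr 2
  ext x
  exact (toLp_mem_closedBall_iff x).symm

lemma volume_euclideanBall_lt_top (n : ℕ) (R : ℝ) : volume (euclideanBall n R) < ⊤ := by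
  have h : euclideanBall n R = (WithLp.toLp 2) ⁻¹'
      Metric.closedBall (0 : EuclideanSpace ℝ (Fin n)) R := by
    ext x
    exact (toLp_mem_closedBall_iff x).symm
  rw [h, (PiLp.volume_preserving_toLp (Fin n)).measure_preimage
      Metric.isClosed_closedBall.measurableSet.nullMeasurableSet]
  exact measure_closedBall_lt_top

lemma abs_le_sqrt_sum_sq {n : ℕ} (x : Fin n → ℝ) (j : Fin n) : |x j| ≤ √(∑ i, x i ^ 2) :=
  Real.abs_le_sqrt (Finset.single_le_sum (f := fun i => x i ^ 2) (fun _ _ => sq_nonneg _)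
    (Finset.mem_univ j))

/-- A reflection turns the frequency `ζ` into a multiple of the first coordinate vector. -/
lemma setIntegral_closedBall_cexp_inner (d : ℕ) (R : ℝ) (ζ : EuclideanSpace ℝ (Fin (d + 1))) :
    ∫ x in Metric.closedBall (0 : EuclideanSpace ℝ (Fin (d + 1))) R,
        Complex.exp (Complex.I * (inner ℝ ζ x : ℝ)) =
      ∫ x in Metric.closedBall (0 : EuclideanSpace ℝ (Fin (d + 1))) R,
        Complex.exp (Complex.I * ‖ζ‖ * (x 0 : ℝ)) := by
  set w : EuclideanSpace ℝ (Fin (d + 1)) := EuclideanSpace.single 0 ‖ζ‖ with hw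
  have hn : ‖ζ‖ = ‖w‖ := by simp [hw]
  set L := (ℝ ∙ (ζ - w))ᗮ.reflection
  have hL : L ζ = w := Submodule.reflection_sub hn
  have hpre : L ⁻¹' Metric.closedBall 0 R = Metric.closedBall 0 R := by
    ext x; simp
  rw [← L.measurePreserving.setIntegral_preimage_emb L.toMeasurableEquiv.measurableEmbedding
    (fun x => Complex.exp (Complex.I * ‖ζ‖ * (x 0 : ℝ))), hpre]
  congr 1
  ext x
  rw [← L.inner_map_map ζ x, hL, hw, EuclideanSpace.inner_single_left]
  push_cast
  simp [mul_assoc]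

lemma insertNth_zero_mem_euclideanBall {d : ℕ} {R t : ℝ} (hR : 0 ≤ R) (y : Fin d → ℝ) :
    ((Fin.insertNth 0 t y : Fin (d + 1) → ℝ) ∈ euclideanBall (d + 1) R) ↔
      |t| ≤ R ∧ y ∈ euclideanBall d √(R ^ 2 - t ^ 2) := by
  have hs : 0 ≤ ∑ i, y i ^ 2 := by positivity
  simp only [euclideanBall, Set.mem_ofPred_eq, Fin.sum_univ_succ, Fin.insertNth_zero',
    Fin.cons_zero, Fin.cons_succ]
  rw [Real.sqrt_le_left hR]
  constructor
  · intro h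
    exact ⟨abs_le_of_sq_le_sq (by linarith) hR, Real.sqrt_le_sqrt (by linarith)⟩
  · rintro ⟨h1, h2⟩
    have h3 : t ^ 2 ≤ R ^ 2 := sq_le_sq' (by linarith [(abs_le.1 h1).1]) (abs_le.1 h1).2
    rw [Real.sqrt_le_sqrt_iff (by linarith)] at h2
    linarith

/-- Slicing the ball by the first coordinate. -/
lemma setIntegral_euclideanBall_first (d : ℕ) {R : ℝ} (hR : 0 ≤ R) {g : ℝ → ℂ}
    (hg : Continuous g) (hg1 : ∀ t, ‖g t‖ ≤ 1) :
    ∫ x in euclideanBall (d + 1) R, g (x 0) =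
      ∫ t in (-R)..R, (volume.real (euclideanBall d √(R ^ 2 - t ^ 2)) : ℂ) * g t := by
  have hmp := (volume_preserving_piFinSuccAbove (fun _ : Fin (d + 1) => ℝ) 0).symm
  have hms := measurableSet_euclideanBall (d + 1) R
  rw [← integral_indicator hms, ← hmp.integral_comp
    (MeasurableEquiv.piFinSuccAbove (fun _ : Fin (d + 1) => ℝ) 0).symm.measurableEmbedding]
  have hint : Integrable ((euclideanBall (d + 1) R).indicator (fun x => g (x 0))) := by
    rw [integrable_indicator_iff hms]
    refine Measure.integrableOn_of_bounded (volume_euclideanBall_lt_top _ _).ne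
      (hg.comp (continuous_apply 0)).aestronglyMeasurable (M := 1) ?_
    exact ae_of_all _ fun x => hg1 _
  have hint' : Integrable (fun z : ℝ × (Fin d → ℝ) =>
      (euclideanBall (d + 1) R).indicator (fun x => g (x 0))
        ((MeasurableEquiv.piFinSuccAbove (fun _ : Fin (d + 1) => ℝ) 0).symm z))
      (volume.prod volume) := hmp.integrable_comp_of_integrable hint
  rw [Measure.volume_eq_prod, integral_prod _ hint',
    intervalIntegral.integral_of_le (by linarith), ← integral_Icc_eq_integral_Ioc,
    ← integral_indicator measurableSet_Icc]
  congr 1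
  ext t
  have hslice : ∀ y : Fin d → ℝ, (euclideanBall (d + 1) R).indicator (fun x => g (x 0))
      ((MeasurableEquiv.piFinSuccAbove (fun _ : Fin (d + 1) => ℝ) 0).symm (t, y)) =
      if |t| ≤ R then (euclideanBall d √(R ^ 2 - t ^ 2)).indicator (fun _ => g t) y else 0 := by
    intro y
    change (euclideanBall (d + 1) R).indicator (fun x => g (x 0)) (Fin.insertNth 0 t y) = _
    by_cases h1 : |t| ≤ R
    · by_cases h2 : y ∈ euclideanBall d √(R ^ 2 - t ^ 2)
      · rw [Set.indicator_of_mem ((insertNth_zero_mem_euclideanBall hR y).2 ⟨h1, h2⟩), if_pos h1,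
          Set.indicator_of_mem h2, Fin.insertNth_apply_same]
      · rw [Set.indicator_of_notMem
          (fun h => h2 ((insertNth_zero_mem_euclideanBall hR y).1 h).2), if_pos h1,
          Set.indicator_of_notMem h2]
    · rw [Set.indicator_of_notMem
          (fun h => h1 ((insertNth_zero_mem_euclideanBall hR y).1 h).1), if_neg h1]
  simp_rw [hslice]
  by_cases h1 : |t| ≤ R
  · rw [Set.indicator_of_mem (Set.mem_Icc.2 (abs_le.1 h1))]
    simp only [if_pos h1]
    rw [integral_indicator (measurableSet_euclideanBall _ _), setIntegral_const,
      Complex.real_smul]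
  · rw [Set.indicator_of_notMem fun h => h1 (abs_le.2 (Set.mem_Icc.1 h))]
    simp [if_neg h1]

/-- The Fourier transform of a Euclidean ball is a one-dimensional oscillatory integral. -/
lemma setIntegral_euclideanBall_cexp (d : ℕ) {R : ℝ} (hR : 0 < R) (ζ : Fin (d + 1) → ℝ) :
    ∫ x in euclideanBall (d + 1) R, Complex.exp (Complex.I * (∑ i, ζ i * x i : ℝ)) =
      R ^ (d + 1) * volume.real (Metric.ball (0 : EuclideanSpace ℝ (Fin d)) 1) *
        ∫ t in (-1 : ℝ)..1, (((1 - t ^ 2) ^ ((d : ℝ) / 2) : ℝ) : ℂ) *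
          Complex.exp (Complex.I * (R * √(∑ i, ζ i ^ 2) : ℝ) * t) := by
  set s := √(∑ i, ζ i ^ 2) with hs
  have hnorm : ‖(WithLp.toLp 2 ζ : EuclideanSpace ℝ (Fin (d + 1)))‖ = s := by
    simp [EuclideanSpace.norm_eq, hs]
  have h1 := setIntegral_closedBall_cexp_inner d R (WithLp.toLp 2 ζ)
  have h2 : ∀ x : EuclideanSpace ℝ (Fin (d + 1)),
      inner ℝ (WithLp.toLp 2 ζ) x = ∑ i, ζ i * WithLp.ofLp x i := by
    intro x
    simp [PiLp.inner_apply, mul_comm]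
  simp_rw [h2, hnorm] at h1
  rw [setIntegral_euclideanBall, h1,
    ← setIntegral_euclideanBall (fun x => Complex.exp (Complex.I * s * (x 0 : ℝ))),
    setIntegral_euclideanBall_first d hR.le (g := fun t => Complex.exp (Complex.I * s * t))
      (by fun_prop) (fun t => (norm_cexp_I_mul s t).le)]
  have h3 := intervalIntegral.smul_integral_comp_mul_left (a := -1) (b := 1)
    (fun t : ℝ => (volume.real (euclideanBall d √(R ^ 2 - t ^ 2)) : ℂ) *
      Complex.exp (Complex.I * s * t)) R
  rw [mul_neg_one, mul_one] at h3
  rw [← h3, Complex.real_smul, ← intervalIntegral.integral_const_mul,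
    ← intervalIntegral.integral_const_mul]
  refine intervalIntegral.integral_congr fun t ht => ?_
  rw [Set.uIcc_of_le (by norm_num)] at ht
  have h4 : (0 : ℝ) ≤ 1 - t ^ 2 := by nlinarith [ht.1, ht.2]
  have h5 : √(R ^ 2 - (R * t) ^ 2) = R * √(1 - t ^ 2) := by
    rw [show R ^ 2 - (R * t) ^ 2 = R ^ 2 * (1 - t ^ 2) by ring, Real.sqrt_mul (sq_nonneg R),
      Real.sqrt_sq hR.le]
  have h6 : √(1 - t ^ 2) ^ d = (1 - t ^ 2) ^ ((d : ℝ) / 2) := by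
    rw [Real.sqrt_eq_rpow, ← Real.rpow_natCast, ← Real.rpow_mul h4]
    congr 1; ring
  rw [volume_real_euclideanBall d (Real.sqrt_nonneg _), h5, mul_pow, h6,
    show Complex.I * s * ((R * t : ℝ) : ℂ) = Complex.I * ((R * s : ℝ) : ℂ) * t by
      push_cast; ring]
  push_cast
  ring

/-- Decay of the Fourier transform of a ball, in dimension `d + 1`; the factor
`1 + R |ζ|` in place of `R |ζ|` covers small frequencies as well. -/
theorem exists_norm_setIntegral_euclideanBall_cexp_le (d : ℕ) :
    ∃ C, 0 ≤ C ∧ ∀ R : ℝ, 0 < R → ∀ ζ : Fin (d + 1) → ℝ,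
      ‖∫ x in euclideanBall (d + 1) R, Complex.exp (Complex.I * (∑ i, ζ i * x i : ℝ))‖ ≤
        C * R ^ (d + 1) * (1 + R * √(∑ i, ζ i ^ 2)) ^ (-(((d : ℝ) + 2) / 2)) := by
  obtain ⟨C, hC⟩ := exists_norm_integral_weight_le (d + 1) 1
  have ha : (0 : ℝ) ≤ ((d : ℝ) + 2) / 2 := by positivity
  set a : ℝ := ((d : ℝ) + 2) / 2 with ha_def
  set D := max C 2
  have hD : 0 ≤ D := le_max_of_le_right zero_le_two
  set c := volume.real (Metric.ball (0 : EuclideanSpace ℝ (Fin d)) 1)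
  have hc : 0 ≤ c := measureReal_nonneg
  have key : ∀ s : ℝ, 0 ≤ s → ‖∫ t in (-1 : ℝ)..1, (((1 - t ^ 2) ^ ((d : ℝ) / 2) : ℝ) : ℂ) *
          Complex.exp (Complex.I * s * t)‖ ≤ D * (2 ^ a * (1 + s) ^ (-a)) := by
    intro s hs
    rcases le_total s 1 with h | h
    · have h1 := norm_integral_mul_weight_cexp_le (β := (d : ℝ) / 2) (M := 1) (s := s) 1
        (by norm_num : (-1 : ℝ) ≤ 1) le_rfl le_rfl (by simp)
        (intervalIntegrable_weight (Or.inr (by positivity)))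
      simp only [Polynomial.eval_one, one_mul] at h1
      have h2 : ∫ t in (-1 : ℝ)..1, (1 - t ^ 2) ^ ((d : ℝ) / 2) ≤ ∫ t in (-1 : ℝ)..1, (1 : ℝ) := by
        refine intervalIntegral.integral_mono_on (by norm_num)
          (intervalIntegrable_weight (Or.inr (by positivity))) (by simp) fun t ht => ?_
        exact Real.rpow_le_one (by nlinarith [ht.1, ht.2]) (by nlinarith) (by positivity)
      have h3 : (1 : ℝ) ≤ 2 ^ a * (1 + s) ^ (-a) := by
        rw [Real.rpow_neg (by linarith), ← div_eq_mul_inv,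
          one_le_div (Real.rpow_pos_of_pos (by linarith) _)]
        exact Real.rpow_le_rpow (by linarith) (by linarith) ha
      have h4 : ∫ t in (-1 : ℝ)..1, (1 : ℝ) = 2 := by norm_num
      calc _ ≤ _ := h1.trans (h2.trans h4.le)
        _ ≤ D * 1 := by rw [mul_one]; exact le_max_right _ _
        _ ≤ _ := mul_le_mul_of_nonneg_left h3 hD
    · have h1 := hC s h
      have e1 : ((((d + 1 : ℕ) : ℝ)) - 1) / 2 = (d : ℝ) / 2 := by push_cast; ring
      have e2 : -((((d + 1 : ℕ) : ℝ) + 1) / 2) = -a := by rw [ha_def]; push_cast; ring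
      rw [e1, e2] at h1
      simp only [Polynomial.eval_one, one_mul] at h1
      have h3 : s ^ (-a) ≤ 2 ^ a * (1 + s) ^ (-a) := by
        rw [Real.rpow_neg (by linarith), Real.rpow_neg (by linarith), ← div_eq_mul_inv,
          ← one_div, div_le_div_iff₀ (Real.rpow_pos_of_pos (by linarith) _)
            (Real.rpow_pos_of_pos (by linarith) _), one_mul,
          ← Real.mul_rpow (by norm_num) (by linarith)]
        exact Real.rpow_le_rpow (by linarith) (by linarith) ha
      calc _ ≤ _ := h1
        _ ≤ D * s ^ (-a) :=
          mul_le_mul_of_nonneg_right (le_max_left _ _) (Real.rpow_nonneg (by linarith) _)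
        _ ≤ _ := mul_le_mul_of_nonneg_left h3 hD
  refine ⟨c * (D * 2 ^ a), by positivity, fun R hR ζ => ?_⟩
  rw [setIntegral_euclideanBall_cexp d hR, norm_mul, norm_mul, norm_pow, Complex.norm_real,
    Complex.norm_real, Real.norm_of_nonneg hR.le, Real.norm_of_nonneg hc]
  refine (mul_le_mul_of_nonneg_left (key (R * √(∑ i, ζ i ^ 2)) (by positivity))
    (by positivity)).trans_eq ?_
  ring

/-! ### Fourier coefficients of a ball in the torus -/

/-- `UnitAddTorus.mFourierCoeff` refers to the product of the Haar probability measures of the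
factors `ℝ / ℤ`; this is the Lebesgue measure. -/
lemma pi_haarAddCircle_eq_volume (n : ℕ) :
    (Measure.pi fun _ : Fin n => (AddCircle.haarAddCircle : Measure UnitAddCircle)) =
      (volume : Measure (UnitAddTorus (Fin n))) := by
  have h : (AddCircle.haarAddCircle : Measure UnitAddCircle) = volume := by
    rw [AddCircle.volume_eq_smul_haarAddCircle]; simp
  rw [h]
  rfl

lemma mFourierCoeff_eq_integral_volume {n : ℕ} (f : UnitAddTorus (Fin n) → ℂ) (v : Fin n → ℤ) :
    UnitAddTorus.mFourierCoeff f v = ∫ t, UnitAddTorus.mFourier (-v) t * f t := by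
  rw [← pi_haarAddCircle_eq_volume]
  rfl

/-- The indicator function of the ball of radius `R` about `0` in the torus. -/
noncomputable def ballIndicator (n : ℕ) (R : ℝ) : UnitAddTorus (Fin n) → ℂ :=
  (torusBall R 0).indicator 1

lemma measurableSet_torusBall {n : ℕ} (R : ℝ) (y : UnitAddTorus (Fin n)) :
    MeasurableSet (torusBall R y) :=
  measurableSet_le (by fun_prop) measurable_const

lemma measurable_ballIndicator (n : ℕ) (R : ℝ) : Measurable (ballIndicator n R) :=
  measurable_one.indicator (measurableSet_torusBall R 0)

lemma norm_ballIndicator_le_one {n : ℕ} {R : ℝ} (x : UnitAddTorus (Fin n)) :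
    ‖ballIndicator n R x‖ ≤ 1 := by
  unfold ballIndicator
  by_cases h : x ∈ torusBall R 0 <;> simp [h]

/-- On the fundamental domain `(-1/2, 1/2]ⁿ` the norm of `ℝ / ℤ` is the absolute value, so the
torus ball is the Euclidean ball there. -/
lemma coe_mem_torusBall_iff {n : ℕ} {R : ℝ} {x : Fin n → ℝ}
    (hx : ∀ i, x i ∈ Set.Ioc (-(1 / 2) : ℝ) (-(1 / 2) + 1)) :
    (fun i => (x i : UnitAddCircle)) ∈ torusBall R (0 : UnitAddTorus (Fin n)) ↔
      x ∈ euclideanBall n R := by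
  have h : ∀ i, ‖(x i : UnitAddCircle)‖ = |x i| := by
    intro i
    rw [AddCircle.norm_coe_eq_abs_iff 1 one_ne_zero, abs_one, abs_le]
    exact ⟨(hx i).1.le, by linarith [(hx i).2]⟩
  change √(∑ j, ‖(x j : UnitAddCircle) - 0‖ ^ 2) ≤ R ↔ √(∑ j, x j ^ 2) ≤ R
  simp [h]

lemma mem_Ioc_of_mem_euclideanBall {n : ℕ} {R : ℝ} (hR : R < 1 / 2) {x : Fin n → ℝ}
    (hx : x ∈ euclideanBall n R) (i : Fin n) : x i ∈ Set.Ioc (-(1 / 2) : ℝ) (-(1 / 2) + 1) := by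
  have h : |x i| ≤ R := (abs_le_sqrt_sum_sq x i).trans hx
  rw [abs_le] at h
  exact ⟨by linarith [h.1], by linarith [h.2]⟩

lemma mFourierCoeff_ballIndicator {n : ℕ} {R : ℝ} (hR : R < 1 / 2) (v : Fin n → ℤ) :
    UnitAddTorus.mFourierCoeff (ballIndicator n R) v =
      ∫ x in euclideanBall n R,
        Complex.exp (Complex.I * (∑ i, (-(2 * Real.pi * v i)) * x i : ℝ)) := by
  have hms := measurableSet_euclideanBall n R
  have hbox : MeasurableSet {x : Fin n → ℝ | ∀ i, x i ∈ Set.Ioc (-(1 / 2) : ℝ) (-(1 / 2) + 1)} :=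
    MeasurableSet.univ_pi' fun i => measurableSet_Ioc
  rw [UnitAddTorus.mFourierCoeff_eq_integral _ _ (fun _ => -(1 / 2)), ← integral_indicator hbox,
    ← integral_indicator hms]
  congr 1
  ext x
  by_cases hx : x ∈ euclideanBall n R
  · have hb := mem_Ioc_of_mem_euclideanBall hR hx
    have hB : x ∈ {x : Fin n → ℝ | ∀ i, x i ∈ Set.Ioc (-(1 / 2) : ℝ) (-(1 / 2) + 1)} := hb
    rw [Set.indicator_of_mem hx, Set.indicator_of_mem hB,
      ballIndicator, Set.indicator_of_mem ((coe_mem_torusBall_iff hb).2 hx)]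
    simp only [UnitAddTorus.mFourier, ContinuousMap.coe_mk, Pi.one_apply, smul_eq_mul, mul_one,
      Pi.neg_apply, fourier_coe_apply]
    rw [← Complex.exp_sum]
    push_cast
    rw [Finset.mul_sum]
    congr 1
    refine Finset.sum_congr rfl fun i _ => ?_
    ring
  · rw [Set.indicator_of_notMem hx]
    by_cases hb : ∀ i, x i ∈ Set.Ioc (-(1 / 2) : ℝ) (-(1 / 2) + 1)
    · have hB : x ∈ {x : Fin n → ℝ | ∀ i, x i ∈ Set.Ioc (-(1 / 2) : ℝ) (-(1 / 2) + 1)} := hb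
      rw [Set.indicator_of_mem hB, ballIndicator,
        Set.indicator_of_notMem fun h => hx ((coe_mem_torusBall_iff hb).1 h), smul_zero]
    · have hB : x ∉ {x : Fin n → ℝ | ∀ i, x i ∈ Set.Ioc (-(1 / 2) : ℝ) (-(1 / 2) + 1)} := hb
      rw [Set.indicator_of_notMem hB]

lemma integral_ballIndicator (n : ℕ) (R : ℝ) :
    ∫ x, ballIndicator n R x = (volume.real (torusBall R (0 : UnitAddTorus (Fin n))) : ℂ) := by
  rw [ballIndicator, integral_indicator (measurableSet_torusBall R 0)]
  simp [Measure.real]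

lemma mFourierCoeff_zero {n : ℕ} (f : UnitAddTorus (Fin n) → ℂ) :
    UnitAddTorus.mFourierCoeff f 0 = ∫ x, f x := by
  simp [mFourierCoeff_eq_integral_volume, UnitAddTorus.mFourier_zero]

lemma volume_real_torusBall {n : ℕ} {R : ℝ} (hR0 : 0 ≤ R) (hR : R < 1 / 2) :
    volume.real (torusBall R (0 : UnitAddTorus (Fin n))) =
      R ^ n * volume.real (Metric.ball (0 : EuclideanSpace ℝ (Fin n)) 1) := by
  have h := mFourierCoeff_ballIndicator (n := n) hR 0
  rw [mFourierCoeff_zero, integral_ballIndicator] at h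
  rw [← volume_real_euclideanBall n hR0]
  have h2 : ∫ _x in euclideanBall n R, (1 : ℂ) = (volume.real (euclideanBall n R) : ℂ) := by
    simp [Measure.real]
  have h3 : (volume.real (torusBall R (0 : UnitAddTorus (Fin n))) : ℂ) =
      volume.real (euclideanBall n R) := by
    rw [h, ← h2]; simp
  exact_mod_cast h3

theorem exists_norm_mFourierCoeff_ballIndicator_sq_le {n : ℕ} (hn : 0 < n) :
    ∃ C : ℝ, 0 ≤ C ∧ ∀ R : ℝ, 0 < R → R < 1 / 2 → ∀ v : Fin n → ℤ,
      ‖UnitAddTorus.mFourierCoeff (ballIndicator n R) v‖ ^ 2 ≤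
        C * (R ^ n) ^ 2 * ((1 + R * √(∑ i, (v i : ℝ) ^ 2)) ^ (n + 1))⁻¹ := by
  obtain ⟨d, rfl⟩ := Nat.exists_eq_succ_of_ne_zero hn.ne'
  obtain ⟨C, hC0, hC⟩ := exists_norm_setIntegral_euclideanBall_cexp_le d
  refine ⟨C ^ 2, by positivity, fun R hR0 hR v => ?_⟩
  rw [mFourierCoeff_ballIndicator hR]
  set r := √(∑ i, (v i : ℝ) ^ 2) with hr
  set ρ := √(∑ i, (-(2 * Real.pi * v i)) ^ 2) with hρ
  have hrρ : r ≤ ρ := by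
    refine Real.sqrt_le_sqrt (Finset.sum_le_sum fun i _ => ?_)
    have h2 : (1 : ℝ) ≤ (2 * Real.pi) ^ 2 := by nlinarith [Real.pi_gt_three]
    nlinarith [sq_nonneg ((v i : ℝ))]
  have h1 := hC R hR0 fun i => -(2 * Real.pi * v i)
  have hr0 : 0 ≤ r := Real.sqrt_nonneg _
  have h2 : (1 + R * ρ) ^ (-(((d : ℝ) + 2) / 2)) ≤ (1 + R * r) ^ (-(((d : ℝ) + 2) / 2)) := by
    refine Real.rpow_le_rpow_of_nonpos (by positivity) (by gcongr) ?_
    have : (0 : ℝ) ≤ d := d.cast_nonneg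
    linarith
  have h3 : ((1 + R * r) ^ (-(((d : ℝ) + 2) / 2))) ^ 2 = ((1 + R * r) ^ (d + 1 + 1))⁻¹ := by
    rw [← Real.rpow_natCast, ← Real.rpow_natCast, ← Real.rpow_mul (by positivity),
      ← Real.rpow_neg (by positivity)]
    congr 1
    push_cast
    ring
  have h4 := h1.trans (mul_le_mul_of_nonneg_left h2 (by positivity))
  refine (pow_le_pow_left₀ (norm_nonneg _) h4 2).trans_eq ?_
  rw [mul_pow, mul_pow, h3]

/-! ### Parseval's identity on the torus -/

lemma hasSum_norm_mFourierCoeff_sq {n : ℕ} {f : UnitAddTorus (Fin n) → ℂ}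
    (hf : MemLp f 2 volume) :
    HasSum (fun v => ‖UnitAddTorus.mFourierCoeff f v‖ ^ 2) (∫ x, ‖f x‖ ^ 2) := by
  rw [← pi_haarAddCircle_eq_volume] at hf ⊢
  have h := UnitAddTorus.hasSum_sq_mFourierCoeff (hf.toLp f)
  have h1 : ∫ x, ‖hf.toLp f x‖ ^ 2 ∂(Measure.pi fun _ => AddCircle.haarAddCircle) =
      ∫ x, ‖f x‖ ^ 2 ∂(Measure.pi fun _ => AddCircle.haarAddCircle) := by
    refine integral_congr_ae ?_
    filter_upwards [hf.coeFn_toLp] with x hx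
    rw [hx]
  have h2 : ∀ v, UnitAddTorus.mFourierCoeff (hf.toLp f) v = UnitAddTorus.mFourierCoeff f v := by
    intro v
    refine integral_congr_ae (Filter.Eventually.mono hf.coeFn_toLp fun x hx => ?_)
    simp only [hx]
  simp only [h2] at h
  exact h1 ▸ h

lemma memLp_two_of_bounded {n : ℕ} {f : UnitAddTorus (Fin n) → ℂ} (hf : Measurable f) {M : ℝ}
    (hM : ∀ x, ‖f x‖ ≤ M) : MemLp f 2 volume :=
  MemLp.of_bound hf.aestronglyMeasurable M (ae_of_all _ hM)

lemma sum_norm_mFourierCoeff_ballIndicator_sq_le {n : ℕ} (R : ℝ) (T : Finset (Fin n → ℤ)) :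
    ∑ v ∈ T, ‖UnitAddTorus.mFourierCoeff (ballIndicator n R) v‖ ^ 2 ≤
      volume.real (torusBall R (0 : UnitAddTorus (Fin n))) := by
  have h := hasSum_norm_mFourierCoeff_sq
    (memLp_two_of_bounded (measurable_ballIndicator n R) norm_ballIndicator_le_one)
  have h1 : ∫ x, ‖ballIndicator n R x‖ ^ 2 =
      volume.real (torusBall R (0 : UnitAddTorus (Fin n))) := by
    rw [← integral_indicator_one (measurableSet_torusBall R 0)]
    congr 1
    ext x
    unfold ballIndicator
    by_cases hx : x ∈ torusBall R 0 <;> simp [hx]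
  rw [← h1]
  exact sum_le_hasSum T (fun v _ => sq_nonneg _) h

lemma mFourierCoeff_comp_sub {n : ℕ} (f : UnitAddTorus (Fin n) → ℂ) (a : UnitAddTorus (Fin n))
    (v : Fin n → ℤ) :
    UnitAddTorus.mFourierCoeff (fun y => f (y - a)) v =
      UnitAddTorus.mFourier (-v) a * UnitAddTorus.mFourierCoeff f v := by
  rw [mFourierCoeff_eq_integral_volume, mFourierCoeff_eq_integral_volume,
    ← integral_add_right_eq_self _ a, ← integral_const_mul]
  congr 1
  ext y
  have h : UnitAddTorus.mFourier (-v) (y + a) =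
      UnitAddTorus.mFourier (-v) y * UnitAddTorus.mFourier (-v) a := by
    simp only [UnitAddTorus.mFourier, ContinuousMap.coe_mk, Pi.add_apply, fourier_apply,
      smul_add, AddCircle.toCircle_add, Circle.coe_mul, Finset.prod_mul_distrib]
  simp only [h, add_sub_cancel_right]
  ring

/-! ### Sums over the integer lattice -/

/-- The points `k` with a given value of `⌊k / L⌋`, where `L = ⌈1 / l⌉`, are grouped together. -/
lemma exists_sum_int_rpow_le {b : ℝ} (hb : 1 < b) :
    ∃ A : ℝ, 0 ≤ A ∧ ∀ l : ℝ, 0 < l → l ≤ 1 → ∀ T : Finset ℤ,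
      ∑ k ∈ T, (1 + l * |(k : ℝ)|) ^ (-b) ≤ A / l := by
  have hsum : Summable fun q : ℤ => (1 + |(q : ℝ)|) ^ (-b) := by
    refine Summable.of_norm_bounded_eventually (Real.summable_abs_int_rpow hb) ?_
    filter_upwards [(Set.finite_singleton (0 : ℤ)).compl_mem_cofinite] with q hq
    have hq' : 0 < |(q : ℝ)| := by simpa using hq
    rw [Real.norm_of_nonneg (by positivity)]
    exact Real.rpow_le_rpow_of_nonpos hq' (by linarith) (by linarith)
  set H : ℤ → ℝ := fun q => ((1 + |(q : ℝ)|) / 2) ^ (-b) with hH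
  have hHsum : Summable H := by
    have : H = fun q : ℤ => (1 + |(q : ℝ)|) ^ (-b) / 2 ^ (-b) := by
      ext q
      exact Real.div_rpow (by positivity) (by norm_num) _
    rw [this]
    exact hsum.div_const _
  have hH0 : ∀ q, 0 ≤ H q := fun q => by positivity
  have hS0 : 0 ≤ ∑' q, H q := tsum_nonneg hH0
  refine ⟨2 * ∑' q, H q, by positivity, fun l hl hl1 T => ?_⟩
  set L : ℕ := ⌈1 / l⌉₊ with hL
  have hL1 : 1 ≤ l * L := by
    have := Nat.le_ceil (1 / l)
    rwa [div_le_iff₀' hl] at this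
  have hL2 : (L : ℝ) ≤ 2 / l := by
    have h1 := (Nat.ceil_lt_add_one (by positivity : 0 ≤ 1 / l)).le
    have h2 : 1 ≤ 1 / l := by rwa [le_div_iff₀ hl, one_mul]
    calc (L : ℝ) ≤ 1 / l + 1 := h1
      _ ≤ 1 / l + 1 / l := by linarith
      _ = 2 / l := by ring
  have hL0 : (0 : ℤ) < L := by
    have : 0 < L := Nat.ceil_pos.2 (by positivity)
    exact_mod_cast this
  have hpt : ∀ k : ℤ, (1 + l * |(k : ℝ)|) ^ (-b) ≤ H (k / L) := by
    intro k
    refine Real.rpow_le_rpow_of_nonpos (by positivity) ?_ (by linarith)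
    set q := k / (L : ℤ) with hq
    have h1 : (L : ℝ) * q ≤ k := by exact_mod_cast Int.mul_ediv_self_le hL0.ne'
    have h2 : (k : ℝ) < L * (q + 1) := by
      have := Int.lt_mul_ediv_self_add (x := k) hL0
      rw [← hq] at this
      have h3 : (k : ℝ) < L * q + L := by exact_mod_cast this
      linarith
    have hLr : (0 : ℝ) < L := by exact_mod_cast hL0
    have h3 : 0 ≤ l * |(k : ℝ)| := by positivity
    rcases lt_trichotomy q 0 with h | h | h
    · have hq1 : (q : ℝ) + 1 ≤ 0 := by exact_mod_cast h
      have : |(q : ℝ)| = -q := abs_of_neg (by linarith)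
      have h4 : l * (L * (-(q + 1))) ≤ l * |(k : ℝ)| := by
        gcongr
        linarith [neg_abs_le (k : ℝ)]
      have h5 : -((q : ℝ) + 1) ≤ l * (L * (-(q + 1))) := by
        nlinarith [mul_nonneg (sub_nonneg.2 hL1) (neg_nonneg.2 hq1)]
      linarith
    · rw [h]; simp; linarith
    · have hq1 : (1 : ℝ) ≤ q := by exact_mod_cast h
      have : |(q : ℝ)| = q := abs_of_pos (by linarith)
      have h4 : l * (L * q) ≤ l * |(k : ℝ)| := by
        gcongr
        linarith [le_abs_self (k : ℝ)]
      have h5 : (q : ℝ) ≤ l * (L * q) := by nlinarith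
      linarith
  have hcard : ∀ q : ℤ, ((T.filter fun k => k / (L : ℤ) = q).card : ℝ) ≤ L := by
    intro q
    have : (T.filter fun k => k / (L : ℤ) = q) ⊆ Finset.Ico (L * q) (L * q + L) := by
      intro k hk
      rw [Finset.mem_filter] at hk
      rw [Finset.mem_Ico, ← hk.2]
      exact ⟨Int.mul_ediv_self_le hL0.ne', Int.lt_mul_ediv_self_add hL0⟩
    have h := Finset.card_le_card this
    simp only [Int.card_Ico, add_sub_cancel_left, Int.toNat_natCast] at h
    exact_mod_cast h
  calc ∑ k ∈ T, (1 + l * |(k : ℝ)|) ^ (-b) ≤ ∑ k ∈ T, H (k / L) :=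
        Finset.sum_le_sum fun k _ => hpt k
    _ = ∑ q ∈ T.image (fun k => k / (L : ℤ)), ∑ k ∈ T with k / (L : ℤ) = q, H (k / L) :=
        (Finset.sum_fiberwise_of_maps_to (fun k hk => Finset.mem_image_of_mem _ hk) _).symm
    _ ≤ ∑ q ∈ T.image (fun k => k / (L : ℤ)), L * H q := by
        refine Finset.sum_le_sum fun q _ => ?_
        rw [Finset.sum_congr rfl fun k hk => by rw [(Finset.mem_filter.1 hk).2],
          Finset.sum_const, nsmul_eq_mul]
        exact mul_le_mul_of_nonneg_right (hcard q) (hH0 q)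
    _ = L * ∑ q ∈ T.image (fun k => k / (L : ℤ)), H q := by rw [Finset.mul_sum]
    _ ≤ (2 / l) * ∑' q, H q :=
        mul_le_mul hL2 (hHsum.sum_le_tsum _ fun q _ => hH0 q) (Finset.sum_nonneg fun q _ => hH0 q)
          (by positivity)
    _ = _ := by ring

/-- For `l ≤ 1`, the lattice sum is dominated by a product of one-dimensional sums. -/
lemma exists_sum_lattice_le_of_le_one {n : ℕ} (hn : 0 < n) :
    ∃ C : ℝ, 0 ≤ C ∧ ∀ l : ℝ, 0 < l → l ≤ 1 → ∀ T : Finset (Fin n → ℤ),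
      ∑ w ∈ T, ((1 + l * √(∑ i, (w i : ℝ) ^ 2)) ^ (n + 1))⁻¹ ≤ C / l ^ n := by
  have hn' : (0 : ℝ) < n := by exact_mod_cast hn
  -- this exponent makes a product of `n` factors `(1 + l |w|) ^ (-b)` equal to the summand
  set b : ℝ := ((n : ℝ) + 1) / n with hb
  have hb1 : 1 < b := by rw [hb, one_lt_div hn']; linarith
  obtain ⟨A, hA0, hA⟩ := exists_sum_int_rpow_le hb1
  refine ⟨A ^ n, by positivity, fun l hl hl1 T => ?_⟩
  have hpt : ∀ w : Fin n → ℤ, ((1 + l * √(∑ i, (w i : ℝ) ^ 2)) ^ (n + 1))⁻¹ ≤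
      ∏ i, (1 + l * |(w i : ℝ)|) ^ (-b) := by
    intro w
    have h1 : ((1 + l * √(∑ i, (w i : ℝ) ^ 2)) ^ (n + 1))⁻¹ =
        ∏ _i : Fin n, (1 + l * √(∑ i, (w i : ℝ) ^ 2)) ^ (-b) := by
      rw [Finset.prod_const, Finset.card_univ, Fintype.card_fin, ← Real.rpow_natCast,
        ← Real.rpow_natCast, ← Real.rpow_neg (by positivity), ← Real.rpow_mul (by positivity)]
      congr 1
      rw [hb]; push_cast; field_simp
    rw [h1]
    refine Finset.prod_le_prod (fun _ _ => by positivity) fun i _ => ?_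
    refine Real.rpow_le_rpow_of_nonpos (by positivity) ?_ (by linarith)
    have := abs_le_sqrt_sum_sq (fun i => (w i : ℝ)) i
    gcongr
  have hsub : T ⊆ Fintype.piFinset fun i => T.image fun w => w i := by
    intro w hw
    rw [Fintype.mem_piFinset]
    exact fun i => Finset.mem_image_of_mem _ hw
  calc _ ≤ ∑ w ∈ T, ∏ i, (1 + l * |(w i : ℝ)|) ^ (-b) := Finset.sum_le_sum fun w _ => hpt w
    _ ≤ ∑ w ∈ Fintype.piFinset fun i => (T.image fun w => w i : Finset ℤ),
          ∏ i, (1 + l * |(w i : ℝ)|) ^ (-b) :=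
        Finset.sum_le_sum_of_subset_of_nonneg hsub fun w _ _ =>
          Finset.prod_nonneg fun _ _ => by positivity
    _ = ∏ i, ∑ k ∈ (T.image fun w => w i : Finset ℤ), (1 + l * |(k : ℝ)|) ^ (-b) :=
        (Finset.prod_univ_sum (fun i => (T.image fun w => w i : Finset ℤ))
          fun _ k => (1 + l * |(k : ℝ)|) ^ (-b)).symm
    _ ≤ ∏ _i : Fin n, A / l :=
        Finset.prod_le_prod (fun i _ => Finset.sum_nonneg fun k _ => by positivity)
          fun i _ => hA l hl hl1 _
    _ = A ^ n / l ^ n := by simp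

/-- For `l > 1` the vector `0` has to be left out, and comparison with the case `l = 1` even gives
the stronger bound `l ^ (-(n + 1))`. -/
theorem exists_sum_lattice_le {n : ℕ} (hn : 0 < n) :
    ∃ C : ℝ, 0 ≤ C ∧ ∀ l : ℝ, 0 < l → ∀ T : Finset (Fin n → ℤ), 0 ∉ T →
      ∑ w ∈ T, ((1 + l * √(∑ i, (w i : ℝ) ^ 2)) ^ (n + 1))⁻¹ ≤ C / l ^ n := by
  obtain ⟨C, hC0, hC⟩ := exists_sum_lattice_le_of_le_one hn
  refine ⟨2 ^ (n + 1) * C, by positivity, fun l hl T hT => ?_⟩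
  rcases le_total l 1 with h | h
  · refine (hC l hl h T).trans (div_le_div_of_nonneg_right ?_ (by positivity))
    exact le_mul_of_one_le_left hC0 (one_le_pow₀ (by norm_num))
  · have hpt : ∀ w ∈ T, ((1 + l * √(∑ i, (w i : ℝ) ^ 2)) ^ (n + 1))⁻¹ ≤
        2 ^ (n + 1) / l ^ n * ((1 + 1 * √(∑ i, (w i : ℝ) ^ 2)) ^ (n + 1))⁻¹ := by
      intro w hw
      have hw0 : w ≠ 0 := fun h => hT (h ▸ hw)
      obtain ⟨j, hj⟩ := Function.ne_iff.1 hw0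
      have h1 : (1 : ℝ) ≤ √(∑ i, (w i : ℝ) ^ 2) := by
        refine le_trans ?_ (abs_le_sqrt_sum_sq (fun i => (w i : ℝ)) j)
        exact_mod_cast Int.one_le_abs hj
      set r := √(∑ i, (w i : ℝ) ^ 2)
      have h2 : l ^ n * (1 + 1 * r) ^ (n + 1) ≤ 2 ^ (n + 1) * (1 + l * r) ^ (n + 1) := by
        calc l ^ n * (1 + 1 * r) ^ (n + 1) ≤ l ^ (n + 1) * (1 + 1 * r) ^ (n + 1) := by
              gcongr
              exact n.le_succ
          _ = (l * (1 + 1 * r)) ^ (n + 1) := (mul_pow _ _ _).symm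
          _ ≤ (2 * (1 + l * r)) ^ (n + 1) := by
              refine pow_le_pow_left₀ (by positivity) ?_ _
              nlinarith
          _ = _ := mul_pow _ _ _
      rw [← div_eq_mul_inv, div_div, inv_eq_one_div, div_le_div_iff₀ (by positivity)
        (by positivity), one_mul]
      exact h2
    refine (Finset.sum_le_sum hpt).trans ?_
    rw [← Finset.mul_sum]
    refine (mul_le_mul_of_nonneg_left (hC 1 one_pos le_rfl T) (by positivity)).trans_eq ?_
    simp; ring

/-! ### The counting function of a polynomial system -/

namespace PolySystem

variable {p n m : ℕ} [Fact p.Prime]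

/-- The characters of the torus at the points of the system are the terms of the Weyl sums. -/
lemma mFourier_point (G : PolySystem p n m) (v : Fin n → ℤ) (x : Fin m → ZMod p) :
    UnitAddTorus.mFourier v (G.point x) =
      ZMod.stdAddChar (∑ j, (v j : ZMod p) * MvPolynomial.eval x (G j)) := by
  have hprod : ∀ f : Fin n → ZMod p,
      ZMod.stdAddChar (∑ j, f j) = ∏ j, ZMod.stdAddChar (f j) := fun f =>
    map_prod (ZMod.stdAddChar (N := p)).toMonoidHom (fun j => Multiplicative.ofAdd (f j)) _
  rw [hprod]
  simp only [UnitAddTorus.mFourier, ContinuousMap.coe_mk, point, fourier_apply]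
  refine Finset.prod_congr rfl fun j _ => ?_
  rw [← map_zsmul, zsmul_eq_mul]
  rfl

/-- As the ball is symmetric, the counting function is a sum of translates of its indicator. -/
lemma mu_image_add_torusBall (G : PolySystem p n m) (R : ℝ) (y : UnitAddTorus (Fin n)) :
    ((G.mu ((fun x => y + x) '' torusBall R 0) : ℝ) : ℂ) =
      ((p : ℂ) ^ m)⁻¹ * ∑ x : Fin m → ZMod p, ballIndicator n R (y - G.point x) := by
  classical
  have h : ∀ x : Fin m → ZMod p,
      G.point x ∈ (fun x => y + x) '' torusBall R 0 ↔ y - G.point x ∈ torusBall R 0 := by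
    intro x
    have hneg : ∀ z : UnitAddTorus (Fin n), z ∈ torusBall R 0 ↔ -z ∈ torusBall R 0 := by
      intro z
      simp [torusBall]
    rw [hneg (y - G.point x), neg_sub, Set.image_add_left, Set.mem_preimage, neg_add_eq_sub]
  rw [mu, Nat.card_eq_fintype_card, Fintype.card_subtype]
  simp only [h, ballIndicator, Set.indicator_apply, Pi.one_apply, Finset.sum_boole]
  push_cast
  rw [div_eq_inv_mul]

lemma measurable_mu_image_add_torusBall (G : PolySystem p n m) (R : ℝ) :
    Measurable fun y : UnitAddTorus (Fin n) =>
      ((G.mu ((fun x => y + x) '' torusBall R 0) : ℝ) : ℂ) := by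
  simp_rw [mu_image_add_torusBall]
  exact (Finset.measurable_sum _ fun x _ =>
    (measurable_ballIndicator n R).comp (measurable_id.sub_const _)).const_mul _

lemma norm_mu_le_one (G : PolySystem p n m) (B : Set (UnitAddTorus (Fin n))) :
    ‖((G.mu B : ℝ) : ℂ)‖ ≤ 1 := by
  have hp : (0 : ℝ) < (p : ℝ) ^ m := by
    have := (Fact.out : p.Prime).pos
    positivity
  rw [Complex.norm_real, mu, Real.norm_of_nonneg (by positivity), div_le_one hp]
  have h : Nat.card {x : Fin m → ZMod p // G.point x ∈ B} ≤ Nat.card (Fin m → ZMod p) :=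
    Nat.card_le_card_of_injective _ Subtype.val_injective
  rw [Nat.card_eq_fintype_card (α := Fin m → ZMod p), Fintype.card_fun, ZMod.card,
    Fintype.card_fin] at h
  exact_mod_cast h

/-- The counting function is the convolution of the point measure of the system with the
indicator of the ball, so its Fourier coefficients are products. -/
lemma mFourierCoeff_mu (G : PolySystem p n m) (R : ℝ) (v : Fin n → ℤ) :
    UnitAddTorus.mFourierCoeff (fun y : UnitAddTorus (Fin n) =>
        ((G.mu ((fun x => y + x) '' torusBall R 0) : ℝ) : ℂ)) v =
      ((p : ℂ) ^ m)⁻¹ * G.weylSum (-v) * UnitAddTorus.mFourierCoeff (ballIndicator n R) v := by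
  have hint : ∀ a : UnitAddTorus (Fin n), Integrable fun y =>
      UnitAddTorus.mFourier (-v) y * ballIndicator n R (y - a) := by
    intro a
    refine Integrable.of_bound (C := 1) ?_ (ae_of_all _ fun y => ?_)
    · exact ((UnitAddTorus.mFourier (-v)).continuous.measurable.mul
        ((measurable_ballIndicator n R).comp (measurable_id.sub_const a))).aestronglyMeasurable
    · rw [norm_mul]
      refine mul_le_one₀ ?_ (norm_nonneg _) (norm_ballIndicator_le_one _)
      exact ((UnitAddTorus.mFourier (-v)).norm_coe_le_norm y).trans_eq UnitAddTorus.mFourier_norm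
  rw [mFourierCoeff_eq_integral_volume]
  simp_rw [mu_image_add_torusBall, mul_left_comm _ ((p : ℂ) ^ m)⁻¹]
  rw [integral_const_mul]
  simp_rw [Finset.mul_sum]
  rw [integral_finsetSum _ fun x _ => hint (G.point x), mul_assoc, weylSum,
    Finset.sum_mul]
  congr 1
  refine Finset.sum_congr rfl fun x _ => ?_
  rw [← mFourier_point, ← mFourierCoeff_comp_sub, mFourierCoeff_eq_integral_volume]

lemma weylSum_zero (G : PolySystem p n m) : G.weylSum 0 = (p : ℂ) ^ m := by
  simp [weylSum, ZMod.card]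

/-- By Parseval's identity, the variance is the sum of the squares of the Fourier coefficients of
the counting function at nonzero frequencies. -/
lemma variance_le_of_sum_le (G : PolySystem p n m) (R : ℝ) {M : ℝ}
    (hM : ∀ T : Finset (Fin n → ℤ), 0 ∉ T →
      ∑ v ∈ T, (‖G.weylSum (-v)‖ / (p : ℝ) ^ m *
        ‖UnitAddTorus.mFourierCoeff (ballIndicator n R) v‖) ^ 2 ≤ M) :
    G.variance (torusBall R 0) ≤ M := by
  classical
  have hp : (p : ℂ) ^ m ≠ 0 := by
    have := (Fact.out : p.Prime).ne_zero
    positivity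
  set V := volume.real (torusBall R (0 : UnitAddTorus (Fin n)))
  set g : UnitAddTorus (Fin n) → ℝ := fun y => G.mu ((fun x => y + x) '' torusBall R 0)
  have hL : MemLp (fun y => (g y : ℂ)) 2 volume :=
    memLp_two_of_bounded (G.measurable_mu_image_add_torusBall R) fun y => G.norm_mu_le_one _
  have hcoeff : ∀ v, ‖UnitAddTorus.mFourierCoeff (fun y => (g y : ℂ)) v‖ =
      ‖G.weylSum (-v)‖ / (p : ℝ) ^ m *
        ‖UnitAddTorus.mFourierCoeff (ballIndicator n R) v‖ := by
    intro v
    rw [mFourierCoeff_mu, norm_mul, norm_mul, norm_inv, norm_pow, Complex.norm_natCast,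
      div_eq_inv_mul]
  have h0 : UnitAddTorus.mFourierCoeff (fun y => (g y : ℂ)) 0 = V := by
    rw [mFourierCoeff_mu, neg_zero, weylSum_zero, inv_mul_cancel₀ hp, one_mul, mFourierCoeff_zero,
      integral_ballIndicator]
  have hmean : ∫ y, g y = V := by
    rw [mFourierCoeff_zero, integral_complex_ofReal] at h0
    exact_mod_cast h0
  have hsum := hasSum_norm_mFourierCoeff_sq hL
  have hsq : ∫ y, g y ^ 2 ≤ V ^ 2 + M := by
    have h1 : ∫ y, ‖(g y : ℂ)‖ ^ 2 = ∫ y, g y ^ 2 := by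
      congr 1
      ext y
      rw [Complex.norm_real, Real.norm_eq_abs, sq_abs]
    rw [← h1]
    refine hasSum_le_of_sum_le hsum fun T => ?_
    have hsub : T ⊆ insert 0 (T.erase 0) := Finset.insert_erase_subset 0 T
    refine (Finset.sum_le_sum_of_subset_of_nonneg hsub fun _ _ _ => sq_nonneg _).trans ?_
    rw [Finset.sum_insert (Finset.notMem_erase 0 T)]
    refine add_le_add ?_ ?_
    · rw [h0, Complex.norm_real, Real.norm_eq_abs, sq_abs]
    · simp_rw [hcoeff]
      exact hM _ (Finset.notMem_erase 0 T)
  have hgm : AEStronglyMeasurable g volume := by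
    have := Complex.measurable_re.comp (G.measurable_mu_image_add_torusBall R)
    exact this.aestronglyMeasurable
  have hgb : ∀ y, ‖g y‖ ≤ 1 := fun y => by
    have := G.norm_mu_le_one ((fun x => y + x) '' torusBall R 0)
    rwa [Complex.norm_real] at this
  have hgi : Integrable g := Integrable.of_bound hgm 1 (ae_of_all _ hgb)
  have hgi2 : Integrable fun y => g y ^ 2 := by
    refine Integrable.of_bound (hgm.pow 2) 1 (ae_of_all _ fun y => ?_)
    rw [norm_pow]
    exact pow_le_one₀ (norm_nonneg _) (hgb y)
  have hvar : G.variance (torusBall R 0) = ∫ y, (g y ^ 2 - 2 * V * g y + V ^ 2) := by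
    unfold variance
    congr 1
    ext y
    change (g y - V) ^ 2 = _
    ring
  have hgi3 : Integrable fun y => g y ^ 2 - 2 * V * g y := hgi2.sub (hgi.const_mul _)
  rw [hvar, integral_add hgi3 (integrable_const _), integral_sub hgi2 (hgi.const_mul _),
    integral_const_mul, hmean, integral_const]
  have huniv : volume.real (Set.univ : Set (UnitAddTorus (Fin n))) = 1 := by
    rw [← pi_haarAddCircle_eq_volume]
    exact probReal_univ
  rw [huniv, one_smul]
  nlinarith

/-- Frequencies divisible by `p`: here the Weyl sums are of no help, and the bound comes from the
decay of the Fourier transform of the ball. -/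
lemma exists_sum_dvd_norm_mFourierCoeff_ballIndicator_sq_le (hn : 0 < n) :
    ∃ C : ℝ, 0 ≤ C ∧ ∀ q : ℕ, 0 < q → ∀ R : ℝ, 0 < R → R < 1 / 2 →
      ∀ T : Finset (Fin n → ℤ), 0 ∉ T → (∀ v ∈ T, ∀ j, (q : ℤ) ∣ v j) →
        ∑ v ∈ T, ‖UnitAddTorus.mFourierCoeff (ballIndicator n R) v‖ ^ 2 ≤
          C * (R ^ n / (q : ℝ) ^ n) := by
  obtain ⟨C₁, hC₁, h₁⟩ := exists_norm_mFourierCoeff_ballIndicator_sq_le hn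
  obtain ⟨C₂, hC₂, h₂⟩ := exists_sum_lattice_le hn
  refine ⟨C₁ * C₂, by positivity, fun q hq R hR0 hR T hT hdvd => ?_⟩
  have hq' : (0 : ℝ) < q := by exact_mod_cast hq
  have hinj : Function.Injective fun w : Fin n → ℤ => fun j => (q : ℤ) * w j := by
    intro w w' h
    ext j
    exact mul_left_cancel₀ (by exact_mod_cast hq.ne') (congrFun h j)
  set T' := T.preimage (fun (w : Fin n → ℤ) (j : Fin n) => (q : ℤ) * w j) hinj.injOn with hT'
  have h0 : 0 ∉ T' := by
    rw [hT', Finset.mem_preimage]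
    simpa only [Pi.zero_apply, mul_zero, ← Pi.zero_def] using hT
  have hpre := Finset.sum_preimage (fun (w : Fin n → ℤ) (j : Fin n) => (q : ℤ) * w j) T hinj.injOn
    (fun v => ‖UnitAddTorus.mFourierCoeff (ballIndicator n R) v‖ ^ 2) (fun v hv hv' => by
      refine absurd ?_ hv'
      choose w hw using hdvd v hv
      exact ⟨w, (funext hw).symm⟩)
  rw [← hpre]
  calc ∑ w ∈ T', ‖UnitAddTorus.mFourierCoeff (ballIndicator n R) fun j => (q : ℤ) * w j‖ ^ 2
      ≤ ∑ w ∈ T', C₁ * (R ^ n) ^ 2 *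
          ((1 + R * q * √(∑ i, (w i : ℝ) ^ 2)) ^ (n + 1))⁻¹ := by
        refine Finset.sum_le_sum fun w _ => (h₁ R hR0 hR _).trans_eq ?_
        have : √(∑ i, (((q : ℤ) * w i : ℤ) : ℝ) ^ 2) = q * √(∑ i, (w i : ℝ) ^ 2) := by
          push_cast
          simp_rw [mul_pow]
          rw [← Finset.mul_sum, Real.sqrt_mul (sq_nonneg _), Real.sqrt_sq hq'.le]
        rw [this, mul_assoc R]
    _ = C₁ * (R ^ n) ^ 2 * ∑ w ∈ T', ((1 + R * q * √(∑ i, (w i : ℝ) ^ 2)) ^ (n + 1))⁻¹ :=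
        (Finset.mul_sum _ _ _).symm
    _ ≤ C₁ * (R ^ n) ^ 2 * (C₂ / (R * q) ^ n) :=
        mul_le_mul_of_nonneg_left (h₂ (R * q) (by positivity) T' h0) (by positivity)
    _ = _ := by rw [mul_pow]; field_simp

end PolySystem

/-- The implied constant `C` depends only on the dimension `n` and on the implied constant `K` in
the type condition; it is uniform in `p`, `m`, `η`, `G` and `R`. -/
theorem theorem1p9 (n : ℕ) (hn : 2 ≤ n) (K : ℝ) :
    ∃ C : ℝ, 0 < C ∧
      ∀ (p : ℕ) [Fact p.Prime] (m : ℕ) (G : PolySystem p n m) (η : ℝ), G.IsOfType η K →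
        ∀ R : ℝ, 0 < R → R < 1 / 2 →
          G.variance (torusBall R 0) ≤ C * (R ^ n / (p : ℝ) ^ min (2 * η) (n : ℝ)) := by
  classical
  obtain ⟨C, hC0, hC⟩ :=
    PolySystem.exists_sum_dvd_norm_mFourierCoeff_ballIndicator_sq_le (n := n) (by omega)
  set c := volume.real (Metric.ball (0 : EuclideanSpace ℝ (Fin n)) 1)
  have hc : 0 ≤ c := measureReal_nonneg
  refine ⟨K ^ 2 * (C + c) + 1, by positivity, fun p _ m G η hG R hR0 hR => ?_⟩
  have hp1 : (1 : ℝ) ≤ p := by exact_mod_cast (Fact.out : p.Prime).one_le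
  have hp0 : (0 : ℝ) < p := by linarith
  set D := R ^ n / (p : ℝ) ^ min (2 * η) (n : ℝ) with hD
  have hD0 : 0 ≤ D := by positivity
  refine (G.variance_le_of_sum_le R (M := K ^ 2 * (C + c) * D) fun T hT => ?_).trans
    (mul_le_mul_of_nonneg_right (by linarith) hD0)
  have hweyl : ∀ v : Fin n → ℤ, (‖G.weylSum (-v)‖ / (p : ℝ) ^ m) ^ 2 ≤
      K ^ 2 * (if ∀ j, (p : ℤ) ∣ v j then 1 else (p : ℝ) ^ (-η)) ^ 2 := by
    intro v
    have h := hG.2 (-v)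
    simp only [Pi.neg_apply, dvd_neg] at h
    rw [← mul_pow]
    refine pow_le_pow_left₀ (by positivity) (h.trans_eq ?_) 2
    congr
  have hn1 : R ^ n / (p : ℝ) ^ n ≤ D := by
    rw [hD, ← Real.rpow_natCast (p : ℝ) n]
    have := Real.rpow_le_rpow_of_exponent_le hp1 (min_le_right (2 * η) (n : ℝ))
    gcongr
  have hη1 : R ^ n * ((p : ℝ) ^ (-η)) ^ 2 ≤ D := by
    have h : ((p : ℝ) ^ (-η)) ^ 2 = ((p : ℝ) ^ (2 * η))⁻¹ := by
      rw [← Real.rpow_natCast, ← Real.rpow_mul hp0.le, ← Real.rpow_neg hp0.le]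
      congr 1
      push_cast
      ring
    rw [h, ← div_eq_mul_inv, hD]
    have := Real.rpow_le_rpow_of_exponent_le hp1 (min_le_left (2 * η) (n : ℝ))
    gcongr
  have hA : ∑ v ∈ T with ∀ j, (p : ℤ) ∣ v j, (‖G.weylSum (-v)‖ / (p : ℝ) ^ m *
      ‖UnitAddTorus.mFourierCoeff (ballIndicator n R) v‖) ^ 2 ≤ K ^ 2 * (C * D) := by
    calc _ ≤ ∑ v ∈ T with ∀ j, (p : ℤ) ∣ v j,
          K ^ 2 * ‖UnitAddTorus.mFourierCoeff (ballIndicator n R) v‖ ^ 2 := by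
          refine Finset.sum_le_sum fun v hv => ?_
          have h := hweyl v
          rw [if_pos (Finset.mem_filter.1 hv).2, one_pow, mul_one] at h
          rw [mul_pow]
          exact mul_le_mul_of_nonneg_right h (sq_nonneg _)
      _ = K ^ 2 * ∑ v ∈ T with ∀ j, (p : ℤ) ∣ v j,
          ‖UnitAddTorus.mFourierCoeff (ballIndicator n R) v‖ ^ 2 := (Finset.mul_sum _ _ _).symm
      _ ≤ K ^ 2 * (C * (R ^ n / (p : ℝ) ^ n)) :=
          mul_le_mul_of_nonneg_left (hC p (Fact.out : p.Prime).pos R hR0 hR _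
            (fun h => hT (Finset.mem_filter.1 h).1) fun v hv => (Finset.mem_filter.1 hv).2)
            (sq_nonneg K)
      _ ≤ _ := by gcongr
  have hB : ∑ v ∈ T with ¬ ∀ j, (p : ℤ) ∣ v j, (‖G.weylSum (-v)‖ / (p : ℝ) ^ m *
      ‖UnitAddTorus.mFourierCoeff (ballIndicator n R) v‖) ^ 2 ≤ K ^ 2 * (c * D) := by
    calc _ ≤ ∑ v ∈ T with ¬ ∀ j, (p : ℤ) ∣ v j, K ^ 2 * ((p : ℝ) ^ (-η)) ^ 2 *
          ‖UnitAddTorus.mFourierCoeff (ballIndicator n R) v‖ ^ 2 := by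
          refine Finset.sum_le_sum fun v hv => ?_
          have h := hweyl v
          rw [if_neg (Finset.mem_filter.1 hv).2] at h
          rw [mul_pow]
          exact mul_le_mul_of_nonneg_right h (sq_nonneg _)
      _ = K ^ 2 * ((p : ℝ) ^ (-η)) ^ 2 * ∑ v ∈ T with ¬ ∀ j, (p : ℤ) ∣ v j,
          ‖UnitAddTorus.mFourierCoeff (ballIndicator n R) v‖ ^ 2 := (Finset.mul_sum _ _ _).symm
      _ ≤ K ^ 2 * ((p : ℝ) ^ (-η)) ^ 2 * (R ^ n * c) := by
          rw [← volume_real_torusBall hR0.le hR]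
          exact mul_le_mul_of_nonneg_left (sum_norm_mFourierCoeff_ballIndicator_sq_le R _)
            (by positivity)
      _ = K ^ 2 * (c * (R ^ n * ((p : ℝ) ^ (-η)) ^ 2)) := by ring
      _ ≤ _ := by gcongr
  rw [← Finset.sum_filter_add_sum_filter_not T (fun v => ∀ j, (p : ℤ) ∣ v j)]
  linarith
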